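/- Let $\Omega=[0,1]$ with Lebesgue measure. For a probability space $(S,\mu)$ and $1\le p<\infty$ let $\exp(L_p)(S)$ be the Orlicz space of (classes of) measurable functions $f:S\to\mathbb R$ with finite Luxemburg norm $$\|f\|_{\exp(L_p)}=\inf\Big\{\lambda>0:\ \int_S \big(e^{(|f|/\lambda)^p}-1\big)\,d\mu\le 1\Big\},$$ and let $\exp(L_\infty)(S)=L_\infty(S)$ with the essential supremum norm. Let $r:\Omega\to\mathbb R$ be a centered Bernoulli random variable (values $\pm1$ with probability $\tfrac12$ each), and for $n\ge 1$ and $f\in\exp(L_p)(\Omega)$ define $A_nf$ on $\Omega^{2n}=(\Omega\times\Omega)^n$ (with product Lebesgue measure) by $$(A_nf)\big((s_1,t_1),\dots,(s_n,t_n)\big)=\sum_{k=1}^n f(s_k)\,r(t_k).$$ Let $1\le p\le\infty$. Then $A_n$ maps $\exp(L_p)(\Omega)$ into $\exp(L_p)(\Omega^{2n})$ for every $n\ge1$, and there is a constant $C>0$, depending only on $p$, such that the operator norm $$\|A_n\|_{\mathcal L(\exp(L_p))}=\sup\{\|A_nf\|_{\exp(L_p)(\Omega^{2n})}:\ \|f\|_{\exp(L_p)(\Omega)}\le1\}$$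 satisfies, for all $n\ge 1$: (i) if $1\le p\le2$, then $\|A_n\|_{\mathcal L(\exp(L_p))}\le C\sqrt n$; (ii) if $2\le p\le\infty$, then $\|A_n\|_{\mathcal L(\exp(L_p))}\le C\,n^{1-1/p}$ (with $1/\infty=0$). -/

import Mathlib

open MeasureTheory
open scoped ENNReal unitInterval

noncomputable section

/-- The function `N_p(u) = e^{u^p} - 1`. -/
def expYoung (p : ℝ) (u : ℝ) : ℝ := Real.exp (u ^ p) - 1

/-- The Luxemburg norm `inf {c > 0 : ∫ M(|f| / c) dμ ≤ 1}` of the Orlicz space `L_M(μ)`, with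
value `∞` if there is no such `c`. -/
def luxemburgNorm {α : Type*} [MeasurableSpace α] (M : ℝ → ℝ) (f : α → ℝ) (μ : Measure α) :
    ℝ≥0∞ :=
  ⨅ (c : ℝ) (_ : 0 < c ∧ ∫⁻ x, ENNReal.ofReal (M (|f x| / c)) ∂μ ≤ 1), ENNReal.ofReal c

/-- The norm of `exp(L_p)(μ)`: the Luxemburg norm for `N_p` if `p < ∞`, and the norm of
`L_∞(μ)` if `p = ∞`. -/
def expLNorm {α : Type*} [MeasurableSpace α] (p : ℝ≥0∞) (f : α → ℝ) (μ : Measure α) : ℝ≥0∞ :=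
  if p = ∞ then eLpNorm f ∞ μ else luxemburgNorm (expYoung p.toReal) f μ

/-- Membership in the space `exp(L_p)(μ)`. -/
def MemExpL {α : Type*} [MeasurableSpace α] (p : ℝ≥0∞) (f : α → ℝ) (μ : Measure α) : Prop :=
  AEStronglyMeasurable f μ ∧ expLNorm p f μ < ∞

/-- `r` is a centered Bernoulli random variable on `[0,1]` with Lebesgue measure: it takes the
values `1` and `-1` with probability `1/2` each. -/
def IsCenteredBernoulli (r : I → ℝ) : Prop :=
  ProbabilityTheory.HasLaw r
    ((2⁻¹ : ℝ≥0∞) • Measure.dirac (1 : ℝ) + (2⁻¹ : ℝ≥0∞) • Measure.dirac (-1 : ℝ)) volume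

/-- The operator `A_n f = (f ⊗ r)_1 + ⋯ + (f ⊗ r)_n`. The product of `2n` copies of `[0,1]` is
written as the `n`-th power of `[0,1] × [0,1]`, with the product Lebesgue measure. -/
def opA (n : ℕ) (r : I → ℝ) (f : I → ℝ) : (Fin n → I × I) → ℝ :=
  fun ω => ∑ i, f (ω i).1 * r (ω i).2

/-- The operator norm of `A_n` from `exp(L_p)` on `[0,1]` to `exp(L_p)` on `[0,1]^{2n}`: the
supremum of the norms of `A_n f` over the closed unit ball of `exp(L_p)`. -/
def opANorm (p : ℝ≥0∞) (n : ℕ) (r : I → ℝ) : ℝ≥0∞ :=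
  ⨆ (f : I → ℝ) (_ : MemExpL p f volume ∧ expLNorm p f volume ≤ 1),
    expLNorm p (opA n r f) volume

end

/-! Randomising by `r` turns the Laplace transform of `opA n r g` at `t` into the `n`-th power of `∫
cosh (t g)` (`lintegral_exp_mul_opA`). For `g` in the unit ball of `exp(L_p)` and `q` conjugate to
`p`, this integral is at most `exp (6 t²)` for `t ≤ 1` and `exp (6 t^q)` for `t ≥ 1`. After division
by `N = √n` if `q ≥ 2`, or `N = n^(1/q)` if `q ≤ 2`, the product in both regimes is at most `exp (6
s^q)` for `s ≥ 1`.

Conversely, such a bound on exponential moments controls the `exp(L_p)` norm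
(`lintegral_expYoung_le_four`), since `z^p` is, up to constants, the Legendre transform of `s^q`.
For `p = 1` the single moment `s = 1` suffices; `p = ∞` is the triangle inequality. -/

/-- Compare power series termwise: `t ^ (2n) ≤ t ^ 2` for `n ≥ 1`. -/
theorem cosh_mul_le_one_add_sq_mul {t : ℝ} (ht0 : 0 ≤ t) (ht1 : t ≤ 1) (x : ℝ) :
    Real.cosh (t * x) ≤ 1 + t ^ 2 * (Real.cosh x - 1) := by
  have h2 := ((hasSum_ite_eq (0 : ℕ) (1 - t ^ 2)).add ((Real.hasSum_cosh x).mul_left (t ^ 2)))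
  refine (hasSum_le (fun n => ?_) (Real.hasSum_cosh (t * x)) h2).trans_eq (by ring)
  rcases Nat.eq_zero_or_pos n with rfl | hn
  · simp
  · rw [if_neg hn.ne', zero_add, mul_pow, mul_div_assoc]
    refine mul_le_mul_of_nonneg_right (pow_le_pow_of_le_one ht0 ht1 (by omega)) ?_
    have : 0 ≤ x ^ (2 * n) := by rw [pow_mul]; positivity
    positivity

theorem cosh_le_exp_abs (x : ℝ) : Real.cosh x ≤ Real.exp |x| := by
  rw [← Real.cosh_abs, Real.cosh_eq]
  have : Real.exp (-|x|) ≤ Real.exp |x| :=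
    Real.exp_le_exp.2 (by linarith [abs_nonneg x])
  linarith

theorem exp_abs_le_exp_add_exp_neg (x : ℝ) : Real.exp |x| ≤ Real.exp x + Real.exp (-x) := by
  rcases abs_cases x with ⟨h, _⟩ | ⟨h, _⟩ <;> rw [h] <;>
    linarith [Real.exp_pos x, Real.exp_pos (-x)]

theorem le_one_add_rpow {p x : ℝ} (hp : 1 ≤ p) (hx : 0 ≤ x) : x ≤ 1 + x ^ p := by
  rcases le_total x 1 with h | h
  · linarith [Real.rpow_nonneg hx p]
  · linarith [Real.self_le_rpow_of_one_le h hp]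

theorem lintegral_ofReal_le_of_le_add_mul {α : Type*} [MeasurableSpace α] {μ : Measure α}
    [IsProbabilityMeasure μ] {u v : α → ℝ} {a b : ℝ} (ha : 0 ≤ a) (hb : 0 ≤ b)
    (huv : ∀ x, u x ≤ a + b * v x) (hv : ∫⁻ x, ENNReal.ofReal (v x) ∂μ ≤ 1) :
    ∫⁻ x, ENNReal.ofReal (u x) ∂μ ≤ ENNReal.ofReal (a + b) := by
  calc ∫⁻ x, ENNReal.ofReal (u x) ∂μ
      ≤ ∫⁻ x, (ENNReal.ofReal a + ENNReal.ofReal b * ENNReal.ofReal (v x)) ∂μ := by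
        refine lintegral_mono fun x => ?_
        rw [← ENNReal.ofReal_mul hb]
        exact (ENNReal.ofReal_le_ofReal (huv x)).trans ENNReal.ofReal_add_le
    _ = ENNReal.ofReal a + ENNReal.ofReal b * ∫⁻ x, ENNReal.ofReal (v x) ∂μ := by
        rw [lintegral_add_left measurable_const, lintegral_const_mul' _ _ ENNReal.ofReal_ne_top]
        simp
    _ ≤ ENNReal.ofReal a + ENNReal.ofReal b * 1 := by gcongr
    _ = ENNReal.ofReal (a + b) := by rw [mul_one, ENNReal.ofReal_add ha hb]

theorem lintegral_cosh_le_exp_sq {α : Type*} [MeasurableSpace α] {μ : Measure α}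
    [IsProbabilityMeasure μ] {p : ℝ} (hp : 1 ≤ p) {g : α → ℝ}
    (hg : ∫⁻ x, ENNReal.ofReal (expYoung p |g x|) ∂μ ≤ 1) {t : ℝ} (ht0 : 0 ≤ t) (ht1 : t ≤ 1) :
    ∫⁻ x, ENNReal.ofReal (Real.cosh (t * g x)) ∂μ ≤ ENNReal.ofReal (Real.exp (6 * t ^ 2)) := by
  have h := lintegral_ofReal_le_of_le_add_mul (u := fun x => Real.cosh (t * g x))
    -- The total `1 + 2e t²` is below `1 + 6 t²`, whence the constant 6.
    (a := 1 + t ^ 2 * Real.exp 1) (b := t ^ 2 * Real.exp 1) (by positivity) (by positivity)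
    (fun x => ?_) hg
  · refine h.trans (ENNReal.ofReal_le_ofReal ?_)
    have h1 := Real.add_one_le_exp (6 * t ^ 2)
    have h2 := Real.exp_one_lt_d9
    nlinarith [sq_nonneg t]
  · have h1 := cosh_mul_le_one_add_sq_mul ht0 ht1 (g x)
    have h2 : Real.cosh (g x) ≤ Real.exp 1 * Real.exp (|g x| ^ p) := by
      rw [← Real.exp_add]
      exact (cosh_le_exp_abs _).trans (Real.exp_le_exp.2 (le_one_add_rpow hp (abs_nonneg _)))
    have h3 := mul_le_mul_of_nonneg_left h2 (sq_nonneg t)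
    simp only [expYoung]
    nlinarith [sq_nonneg t]

theorem lintegral_cosh_le_exp_rpow {α : Type*} [MeasurableSpace α] {μ : Measure α}
    [IsProbabilityMeasure μ] {p q : ℝ} (hpq : p.HolderConjugate q) {g : α → ℝ}
    (hg : ∫⁻ x, ENNReal.ofReal (expYoung p |g x|) ∂μ ≤ 1) {t : ℝ} (ht : 1 ≤ t) :
    ∫⁻ x, ENNReal.ofReal (Real.cosh (t * g x)) ∂μ ≤ ENNReal.ofReal (Real.exp (6 * t ^ q)) := by
  have ht0 : 0 ≤ t := by linarith
  have h := lintegral_ofReal_le_of_le_add_mul (u := fun x => Real.cosh (t * g x))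
    (a := Real.exp (t ^ q)) (b := Real.exp (t ^ q)) (by positivity) (by positivity)
    (fun x => ?_) hg
  · refine h.trans (ENNReal.ofReal_le_ofReal ?_)
    have h1 : 1 ≤ t ^ q := Real.one_le_rpow ht hpq.symm.nonneg
    have h2 : 2 ≤ Real.exp (t ^ q) := by linarith [Real.add_one_le_exp (t ^ q)]
    calc Real.exp (t ^ q) + Real.exp (t ^ q) ≤ Real.exp (t ^ q) * Real.exp (t ^ q) := by
          nlinarith
      _ = Real.exp (2 * t ^ q) := by rw [← Real.exp_add]; ring_nf
      _ ≤ Real.exp (6 * t ^ q) := Real.exp_le_exp.2 (by linarith)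
  · have h1 := Real.young_inequality_of_nonneg (abs_nonneg (g x)) ht0 hpq
    have h2 : |g x| ^ p / p ≤ |g x| ^ p :=
      div_le_self (Real.rpow_nonneg (abs_nonneg _) _) hpq.lt.le
    have h3 : t ^ q / q ≤ t ^ q := div_le_self (Real.rpow_nonneg ht0 _) hpq.symm.lt.le
    calc Real.cosh (t * g x) ≤ Real.exp |t * g x| := cosh_le_exp_abs _
      _ ≤ Real.exp (t ^ q + |g x| ^ p) := by
          rw [abs_mul, abs_of_nonneg ht0]; exact Real.exp_le_exp.2 (by linarith)
      _ = Real.exp (t ^ q) + Real.exp (t ^ q) * expYoung p |g x| := by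
          rw [Real.exp_add, expYoung]; ring

/-! ### Tensorisation of exponential moments -/

theorem lintegral_pi_prod_eq_pow {β : Type*} [MeasureSpace β]
    [IsProbabilityMeasure (volume : Measure β)] (n : ℕ) {h : β → ℝ≥0∞}
    (hh : AEMeasurable h volume) :
    ∫⁻ ω : Fin n → β, ∏ i, h (ω i) = (∫⁻ x, h x) ^ n := by
  have hmp (i : Fin n) : MeasurePreserving (Function.eval i : (Fin n → β) → β) volume volume :=
    measurePreserving_eval (fun _ => (volume : Measure β)) i
  have h1 : (fun ω : Fin n → β => ∏ i, h (ω i)) =ᵐ[volume] fun ω => ∏ i, hh.mk h (ω i) := by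
    have : ∀ᵐ ω : Fin n → β, ∀ i, h (ω i) = hh.mk h (ω i) :=
      ae_all_iff.2 fun i => (hmp i).quasiMeasurePreserving.ae_eq_comp hh.ae_eq_mk
    filter_upwards [this] with ω hω
    exact Finset.prod_congr rfl fun i _ => hω i
  have h2 : ∀ i : Fin n, ∫⁻ ω : Fin n → β, hh.mk h (ω i) = ∫⁻ x, h x := fun i => by
    rw [lintegral_congr_ae hh.ae_eq_mk]
    exact (hmp i).lintegral_comp hh.measurable_mk
  rw [volume_pi] at h1 h2 ⊢
  rw [lintegral_congr_ae h1, ProbabilityTheory.lintegral_prod_eq_prod_lintegral_of_indepFun Finset.univ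
    (fun i (ω : Fin n → β) => hh.mk h (ω i))
    (ProbabilityTheory.iIndepFun_pi (μ := fun _ => (volume : Measure β))
      fun _ => hh.measurable_mk.aemeasurable)
    (fun i => hh.measurable_mk.comp (measurable_pi_apply i)), Finset.prod_congr rfl fun i _ => h2 i]
  simp

theorem aemeasurable_fst_mul_snd {f r : I → ℝ} (hf : AEMeasurable f volume)
    (hr : AEMeasurable r volume) :
    AEMeasurable (fun z : I × I => f z.1 * r z.2) volume :=
  (hf.comp_quasiMeasurePreserving Measure.quasiMeasurePreserving_fst).mul
    (hr.comp_quasiMeasurePreserving Measure.quasiMeasurePreserving_snd)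

theorem aemeasurable_opA {f r : I → ℝ} (n : ℕ) (hf : AEMeasurable f volume)
    (hr : AEMeasurable r volume) : AEMeasurable (opA n r f) volume :=
  Finset.aemeasurable_fun_sum _ fun i _ =>
    (aemeasurable_fst_mul_snd hf hr).comp_quasiMeasurePreserving
      (Measure.quasiMeasurePreserving_eval (fun _ => (volume : Measure (I × I))) i)

theorem lintegral_exp_mul_bernoulli {f r : I → ℝ} (hf : AEMeasurable f volume)
    (hr : IsCenteredBernoulli r) (t : ℝ) :
    ∫⁻ z : I × I, ENNReal.ofReal (Real.exp (t * (f z.1 * r z.2))) =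
      ∫⁻ s : I, ENNReal.ofReal (Real.cosh (t * f s)) := by
  have hm := ((aemeasurable_fst_mul_snd hf hr.aemeasurable).const_mul t).exp.ennreal_ofReal
  rw [Measure.volume_eq_prod] at hm ⊢
  rw [lintegral_prod _ hm]
  refine lintegral_congr fun s => ?_
  rw [ProbabilityTheory.HasLaw.lintegral_comp hr
    (f := fun y => ENNReal.ofReal (Real.exp (t * (f s * y)))) (by fun_prop)]
  rw [lintegral_add_measure, lintegral_smul_measure, lintegral_smul_measure, lintegral_dirac,
    lintegral_dirac, Real.cosh_eq, ENNReal.ofReal_div_of_pos two_pos,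
    ENNReal.ofReal_add (by positivity) (by positivity), smul_eq_mul, smul_eq_mul, ← mul_add,
    ENNReal.div_eq_inv_mul]
  simp

theorem lintegral_exp_mul_opA {f r : I → ℝ} (hf : AEMeasurable f volume)
    (hr : IsCenteredBernoulli r) (n : ℕ) (t : ℝ) :
    ∫⁻ ω, ENNReal.ofReal (Real.exp (t * opA n r f ω)) =
      (∫⁻ s : I, ENNReal.ofReal (Real.cosh (t * f s))) ^ n := by
  rw [← lintegral_exp_mul_bernoulli hf hr, ← lintegral_pi_prod_eq_pow n
    ((aemeasurable_fst_mul_snd hf hr.aemeasurable).const_mul t).exp.ennreal_ofReal]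
  refine lintegral_congr fun ω => ?_
  rw [opA, Finset.mul_sum, Real.exp_sum, ENNReal.ofReal_prod_of_nonneg fun i _ => by positivity]

theorem lintegral_exp_mul_abs_opA_le {f r : I → ℝ} (hf : AEMeasurable f volume)
    (hr : IsCenteredBernoulli r) (n : ℕ) {t : ℝ} (ht : 0 ≤ t) :
    ∫⁻ ω, ENNReal.ofReal (Real.exp (t * |opA n r f ω|)) ≤
      2 * (∫⁻ s : I, ENNReal.ofReal (Real.cosh (t * f s))) ^ n := by
  have hm : AEMeasurable (fun ω => ENNReal.ofReal (Real.exp (t * opA n r f ω))) volume :=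
    ((aemeasurable_opA n hf hr.aemeasurable).const_mul t).exp.ennreal_ofReal
  have hneg := lintegral_exp_mul_opA hf hr n (-t)
  simp only [neg_mul, Real.cosh_neg] at hneg
  rw [two_mul]
  nth_rewrite 1 [← lintegral_exp_mul_opA hf hr n t]
  rw [← hneg, ← lintegral_add_left' hm]
  refine lintegral_mono fun ω => ?_
  rw [← ENNReal.ofReal_add (by positivity) (by positivity)]
  refine ENNReal.ofReal_le_ofReal ?_
  have := exp_abs_le_exp_add_exp_neg (t * opA n r f ω)
  rwa [abs_mul, abs_of_nonneg ht] at this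

/-! ### From exponential moments back to the Luxemburg norm -/

/-- Convexity and vanishing at 0; it lets an integral bound `L` be traded for a factor `L` in the
norm. -/
theorem expYoung_div_le {p L u : ℝ} (hp : 1 ≤ p) (hL : 1 ≤ L) (hu : 0 ≤ u) :
    expYoung p (u / L) ≤ L⁻¹ * expYoung p u := by
  have hL0 : 0 < L := by linarith
  have hLi : 0 ≤ L⁻¹ := by positivity
  have hLi1 : L⁻¹ ≤ 1 := inv_le_one_of_one_le₀ hL
  have h1 : (u / L) ^ p ≤ L⁻¹ * u ^ p := by
    rw [div_eq_inv_mul, Real.mul_rpow hLi hu]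
    exact mul_le_mul_of_nonneg_right
      (Real.rpow_le_self_of_le_one hLi hLi1 hp) (Real.rpow_nonneg hu _)
  have h2 := convexOn_exp.2 (Set.mem_univ (u ^ p)) (Set.mem_univ 0) hLi
    (sub_nonneg.2 hLi1) (by ring)
  simp only [smul_eq_mul, mul_zero, add_zero, Real.exp_zero, mul_one] at h2
  have h3 := Real.exp_le_exp.2 h1
  simp only [expYoung]
  linarith

theorem lintegral_expYoung_div_le_one {α : Type*} [MeasurableSpace α] {μ : Measure α} {Y : α → ℝ}
    {p K L : ℝ} (hp : 1 ≤ p) (hK : 0 < K) (hL : 1 ≤ L)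
    (h : ∫⁻ x, ENNReal.ofReal (expYoung p (|Y x| / K)) ∂μ ≤ ENNReal.ofReal L) :
    ∫⁻ x, ENNReal.ofReal (expYoung p (|Y x| / (K * L))) ∂μ ≤ 1 := by
  have hL0 : 0 < L := by linarith
  calc ∫⁻ x, ENNReal.ofReal (expYoung p (|Y x| / (K * L))) ∂μ
      ≤ ∫⁻ x, ENNReal.ofReal L⁻¹ * ENNReal.ofReal (expYoung p (|Y x| / K)) ∂μ := by
        refine lintegral_mono fun x => ?_
        rw [← ENNReal.ofReal_mul (by positivity), ← div_div]
        exact ENNReal.ofReal_le_ofReal (expYoung_div_le hp hL (by positivity))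
    _ = ENNReal.ofReal L⁻¹ * ∫⁻ x, ENNReal.ofReal (expYoung p (|Y x| / K)) ∂μ :=
        lintegral_const_mul' _ _ ENNReal.ofReal_ne_top
    _ ≤ ENNReal.ofReal L⁻¹ * ENNReal.ofReal L := by gcongr
    _ = 1 := by
        rw [← ENNReal.ofReal_mul (by positivity), inv_mul_cancel₀ hL0.ne', ENNReal.ofReal_one]

/-- A discrete Legendre transform: one integer near the optimal slope `z^(p-1)` already gives a
large enough term, and the sum over all integers removes the dependence on `z`. -/
theorem expYoung_le_add_tsum {p q z : ℝ} (hpq : p.HolderConjugate q) (hz : 0 ≤ z) :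
    ENNReal.ofReal (expYoung p z) ≤ 2 + ∑' k : ℕ, ENNReal.ofReal
      (Real.exp (((k : ℝ) + 1) * ((7 * 2 ^ q + 1) * z) - 7 * ((k : ℝ) + 1) ^ q)) := by
  rcases le_total z 1 with h | h
  · refine le_add_right ?_
    have h1 : Real.exp (z ^ p) ≤ Real.exp 1 :=
      Real.exp_le_exp.2 (Real.rpow_le_one hz h hpq.nonneg)
    rw [← ENNReal.ofReal_ofNat]
    refine ENNReal.ofReal_le_ofReal ?_
    simp only [expYoung]
    linarith [Real.exp_one_lt_d9]
  · refine le_add_left ?_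
    set w := z ^ (p - 1) with hw
    have hw1 : 1 ≤ w := Real.one_le_rpow h hpq.sub_one_pos.le
    have hwz : w * z = z ^ p := by
      rw [hw, ← Real.rpow_add_one (by linarith), sub_add_cancel]
    have hwq : w ^ q = z ^ p := by rw [hw, ← Real.rpow_mul hz, hpq.sub_one_mul_conj]
    obtain ⟨k, hk⟩ : ∃ k, ⌈w⌉₊ = k + 1 :=
      Nat.exists_eq_succ_of_ne_zero (Nat.ceil_pos.2 (by linarith)).ne'
    have hkc : ((⌈w⌉₊ : ℕ) : ℝ) = k + 1 := by rw [hk]; push_cast; rfl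
    have hlow : w ≤ (k : ℝ) + 1 := hkc ▸ Nat.le_ceil w
    have hup : (k : ℝ) + 1 ≤ 2 * w := by
      have := Nat.ceil_lt_add_one (a := w) (by linarith)
      linarith
    refine le_trans (ENNReal.ofReal_le_ofReal ?_) (ENNReal.le_tsum k)
    have h1 : ((k : ℝ) + 1) ^ q ≤ 2 ^ q * z ^ p := by
      rw [← hwq, ← Real.mul_rpow zero_le_two (by linarith)]
      exact Real.rpow_le_rpow (by positivity) hup hpq.symm.nonneg
    -- Of this, `7 * 2 ^ q * z ^ p` pays for the subtracted term and `z ^ p` remains.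
    have h2 : (7 * 2 ^ q + 1) * z ^ p ≤ ((k : ℝ) + 1) * ((7 * 2 ^ q + 1) * z) := by
      rw [← hwz, mul_left_comm]
      have : (0 : ℝ) ≤ (7 * 2 ^ q + 1) * z := by positivity
      exact mul_le_mul_of_nonneg_right hlow this
    simp only [expYoung]
    refine (sub_le_self _ zero_le_one).trans (Real.exp_le_exp.2 ?_)
    linarith

theorem lintegral_expYoung_le_four {α : Type*} [MeasurableSpace α] {μ : Measure α}
    [IsProbabilityMeasure μ] {p q : ℝ} (hpq : p.HolderConjugate q) {Y : α → ℝ}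
    (hY : AEMeasurable Y μ)
    (h : ∀ s : ℝ, 1 ≤ s → ∫⁻ x, ENNReal.ofReal (Real.exp (s * |Y x|)) ∂μ ≤
      2 * ENNReal.ofReal (Real.exp (6 * s ^ q))) :
    ∫⁻ x, ENNReal.ofReal (expYoung p (|Y x| / (7 * 2 ^ q + 1))) ∂μ ≤ ENNReal.ofReal 4 := by
  have hB : (0 : ℝ) < 7 * 2 ^ q + 1 := by positivity
  have hterm (k : ℕ) : ∫⁻ x, ENNReal.ofReal
      (Real.exp (((k : ℝ) + 1) * |Y x| - 7 * ((k : ℝ) + 1) ^ q)) ∂μ ≤ 2 * 2⁻¹ ^ (k + 1) := by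
    have hk : (1 : ℝ) ≤ k + 1 := by linarith [(Nat.cast_nonneg k : (0 : ℝ) ≤ k)]
    have hkq : (k : ℝ) + 1 ≤ ((k : ℝ) + 1) ^ q := Real.self_le_rpow_of_one_le hk hpq.symm.lt.le
    -- The excess of 7 over 6 makes the series geometric.
    have hexp : Real.exp (6 * ((k : ℝ) + 1) ^ q) * Real.exp (-(7 * ((k : ℝ) + 1) ^ q)) ≤
        2⁻¹ ^ (k + 1) := by
      rw [← Real.exp_add]
      calc Real.exp (6 * ((k : ℝ) + 1) ^ q + -(7 * ((k : ℝ) + 1) ^ q))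
          ≤ Real.exp (((k + 1 : ℕ) : ℝ) * (-1)) := Real.exp_le_exp.2 (by push_cast; linarith)
        _ = Real.exp (-1) ^ (k + 1) := Real.exp_nat_mul _ _
        _ ≤ 2⁻¹ ^ (k + 1) := by
          refine pow_le_pow_left₀ (Real.exp_pos _).le ?_ _
          rw [Real.exp_neg]
          exact inv_anti₀ two_pos (by linarith [Real.exp_one_gt_d9])
    calc ∫⁻ x, ENNReal.ofReal (Real.exp (((k : ℝ) + 1) * |Y x| - 7 * ((k : ℝ) + 1) ^ q)) ∂μ
        = (∫⁻ x, ENNReal.ofReal (Real.exp (((k : ℝ) + 1) * |Y x|)) ∂μ) *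
            ENNReal.ofReal (Real.exp (-(7 * ((k : ℝ) + 1) ^ q))) := by
          rw [← lintegral_mul_const' _ _ ENNReal.ofReal_ne_top]
          refine lintegral_congr fun x => ?_
          rw [sub_eq_add_neg, Real.exp_add, ENNReal.ofReal_mul (Real.exp_pos _).le]
      _ ≤ 2 * ENNReal.ofReal (Real.exp (6 * ((k : ℝ) + 1) ^ q)) *
            ENNReal.ofReal (Real.exp (-(7 * ((k : ℝ) + 1) ^ q))) := by
          gcongr
          exact h _ hk
      _ ≤ 2 * 2⁻¹ ^ (k + 1) := by
          rw [mul_assoc, ← ENNReal.ofReal_mul (Real.exp_pos _).le]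
          refine mul_le_mul_right ((ENNReal.ofReal_le_ofReal hexp).trans_eq ?_) _
          rw [ENNReal.ofReal_pow (by positivity), ENNReal.ofReal_inv_of_pos two_pos,
            ENNReal.ofReal_ofNat]
  calc ∫⁻ x, ENNReal.ofReal (expYoung p (|Y x| / (7 * 2 ^ q + 1))) ∂μ
      ≤ ∫⁻ x, (2 + ∑' k : ℕ, ENNReal.ofReal
          (Real.exp (((k : ℝ) + 1) * |Y x| - 7 * ((k : ℝ) + 1) ^ q))) ∂μ := by
        refine lintegral_mono fun x => ?_
        refine (expYoung_le_add_tsum hpq (by positivity)).trans_eq ?_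
        simp only [mul_div_cancel₀ _ hB.ne']
    _ = 2 + ∑' k : ℕ, ∫⁻ x, ENNReal.ofReal
          (Real.exp (((k : ℝ) + 1) * |Y x| - 7 * ((k : ℝ) + 1) ^ q)) ∂μ := by
        rw [lintegral_add_left measurable_const, lintegral_tsum fun k => by fun_prop]
        simp
    _ ≤ 2 + ∑' k : ℕ, 2 * 2⁻¹ ^ (k + 1) := by
        gcongr with k
        exact hterm k
    _ = ENNReal.ofReal 4 := by
        rw [ENNReal.tsum_mul_left, ENNReal.tsum_geometric_add_one, ENNReal.one_sub_inv_two, inv_inv,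
          ENNReal.inv_mul_cancel two_ne_zero ENNReal.ofNat_ne_top]
        norm_num

/-! ### Norm bounds for the operator -/

theorem opA_div (n : ℕ) (r f : I → ℝ) (c : ℝ) (ω : Fin n → I × I) :
    opA n r (fun s => f s / c) ω = opA n r f ω / c := by
  simp only [opA, Finset.sum_div, div_mul_eq_mul_div]

theorem luxemburgNorm_le {α : Type*} [MeasurableSpace α] {μ : Measure α} {M : ℝ → ℝ} {f : α → ℝ}
    {c : ℝ} (hc : 0 < c) (h : ∫⁻ x, ENNReal.ofReal (M (|f x| / c)) ∂μ ≤ 1) :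
    luxemburgNorm M f μ ≤ ENNReal.ofReal c :=
  iInf₂_le c ⟨hc, h⟩

/-- By homogeneity, each `c` admissible for `f` makes `D * c` admissible for the image; the infimum
need not be attained. -/
theorem expLNorm_opA_le {p : ℝ≥0∞} (hp : p ≠ ∞) {n : ℕ} {r : I → ℝ} {D : ℝ} (hD : 0 < D)
    (h : ∀ g : I → ℝ, AEMeasurable g volume →
      ∫⁻ s, ENNReal.ofReal (expYoung p.toReal |g s|) ≤ 1 →
      ∫⁻ ω, ENNReal.ofReal (expYoung p.toReal (|opA n r g ω| / D)) ≤ 1)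
    {f : I → ℝ} (hf : AEMeasurable f volume) :
    expLNorm p (opA n r f) volume ≤ ENNReal.ofReal D * expLNorm p f volume := by
  rw [expLNorm, if_neg hp, expLNorm, if_neg hp, luxemburgNorm.eq_def _ f,
    ENNReal.mul_iInf_of_ne (ENNReal.ofReal_pos.2 hD).ne' ENNReal.ofReal_ne_top]
  refine le_iInf fun c => ?_
  rw [ENNReal.mul_iInf_of_ne (ENNReal.ofReal_pos.2 hD).ne' ENNReal.ofReal_ne_top]
  refine le_iInf fun ⟨hc, hfc⟩ => ?_
  rw [← ENNReal.ofReal_mul hD.le]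
  refine luxemburgNorm_le (by positivity) ?_
  have := h (fun s => f s / c) (hf.div_const c) (by simpa only [abs_div, abs_of_pos hc] using hfc)
  simpa only [opA_div, abs_div, abs_of_pos hc, div_div, mul_comm D c] using this

theorem memExpL_opA_and_opANorm_le {p : ℝ≥0∞} {n : ℕ} {r : I → ℝ} (hr : IsCenteredBernoulli r)
    {D : ℝ} (h : ∀ f : I → ℝ, AEMeasurable f volume →
      expLNorm p (opA n r f) volume ≤ ENNReal.ofReal D * expLNorm p f volume) :
    (∀ f : I → ℝ, MemExpL p f volume → MemExpL p (opA n r f) volume) ∧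
      opANorm p n r ≤ ENNReal.ofReal D := by
  refine ⟨fun f hf => ⟨(aemeasurable_opA n hf.1.aemeasurable hr.aemeasurable).aestronglyMeasurable,
    (h f hf.1.aemeasurable).trans_lt (ENNReal.mul_lt_top ENNReal.ofReal_lt_top hf.2)⟩,
    iSup₂_le fun f hf => (h f hf.1.1.aemeasurable).trans ?_⟩
  exact mul_le_of_le_one_right' hf.2

theorem ae_abs_eq_one_of_isCenteredBernoulli {r : I → ℝ} (hr : IsCenteredBernoulli r) :
    ∀ᵐ t, |r t| = 1 := by
  rw [ProbabilityTheory.HasLaw.ae_iff hr (p := fun y => |y| = 1)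
    (measurableSet_setOfPred.1 (measurableSet_eq_fun measurable_norm measurable_const))]
  simp [ae_add_measure_iff]

theorem eLpNorm_top_opA_le {r : I → ℝ} (hr : IsCenteredBernoulli r) (n : ℕ) (f : I → ℝ) :
    eLpNorm (opA n r f) ∞ volume ≤ ENNReal.ofReal n * eLpNorm f ∞ volume := by
  have h1 : ∀ᵐ z : I × I, ‖f z.1 * r z.2‖ₑ ≤ eLpNorm f ∞ volume := by
    have hf : ∀ᵐ s, ‖f s‖ₑ ≤ eLpNorm f ∞ volume := by
      rw [eLpNorm_exponent_top]; exact ae_le_eLpNormEssSup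
    filter_upwards [Measure.quasiMeasurePreserving_fst.ae hf,
      Measure.quasiMeasurePreserving_snd.ae (ae_abs_eq_one_of_isCenteredBernoulli hr)] with z h2 h3
    have h4 : ‖r z.2‖ₑ = 1 := by
      rw [← ofReal_norm, Real.norm_eq_abs, h3, ENNReal.ofReal_one]
    rwa [enorm_mul, h4, mul_one]
  have h2 : ∀ᵐ ω : Fin n → I × I, ∀ i, ‖f (ω i).1 * r (ω i).2‖ₑ ≤ eLpNorm f ∞ volume :=
    ae_all_iff.2 fun i =>
      (Measure.quasiMeasurePreserving_eval (fun _ => (volume : Measure (I × I))) i).ae h1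
  rw [eLpNorm_exponent_top]
  refine eLpNormEssSup_le_of_ae_enorm_bound ?_
  filter_upwards [h2] with ω hω
  calc ‖opA n r f ω‖ₑ ≤ ∑ i, ‖f (ω i).1 * r (ω i).2‖ₑ := enorm_sum_le _ _
    _ ≤ ∑ _i : Fin n, eLpNorm f ∞ volume := Finset.sum_le_sum fun i _ => hω i
    _ = ENNReal.ofReal n * eLpNorm f ∞ volume := by simp

theorem lintegral_exp_mul_abs_opA_div_le {g r : I → ℝ} (hg : AEMeasurable g volume)
    (hr : IsCenteredBernoulli r) {n : ℕ} {s N b B : ℝ} (hs : 0 ≤ s) (hN : 0 < N)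
    (hb : ∫⁻ x, ENNReal.ofReal (Real.cosh (s / N * g x)) ≤ ENNReal.ofReal (Real.exp b))
    (hbB : n * b ≤ B) :
    ∫⁻ ω, ENNReal.ofReal (Real.exp (s * |opA n r g ω / N|)) ≤
      2 * ENNReal.ofReal (Real.exp B) := by
  calc ∫⁻ ω, ENNReal.ofReal (Real.exp (s * |opA n r g ω / N|))
      = ∫⁻ ω, ENNReal.ofReal (Real.exp (s / N * |opA n r g ω|)) := by
        refine lintegral_congr fun ω => ?_
        rw [abs_div, abs_of_pos hN, mul_div_assoc', div_mul_eq_mul_div]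
    _ ≤ 2 * (∫⁻ x, ENNReal.ofReal (Real.cosh (s / N * g x))) ^ n :=
        lintegral_exp_mul_abs_opA_le hg hr n (by positivity)
    _ ≤ 2 * ENNReal.ofReal (Real.exp b) ^ n := by gcongr
    _ ≤ 2 * ENNReal.ofReal (Real.exp B) := by
        rw [← ENNReal.ofReal_pow (Real.exp_pos _).le, ← Real.exp_nat_mul]
        gcongr

/-- Sums normalised by `N` lie in a fixed ball of `exp(L_p)` as soon as the two regimes of the
cumulant bound, at small and at large arguments, tensorise. -/
theorem lintegral_expYoung_opA_le_one {p q : ℝ} (hpq : p.HolderConjugate q) {g r : I → ℝ}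
    (hg : AEMeasurable g volume) (hr : IsCenteredBernoulli r)
    (hgp : ∫⁻ s, ENNReal.ofReal (expYoung p |g s|) ≤ 1) {n : ℕ} {N : ℝ} (hN : 0 < N)
    (hsmall : ∀ s : ℝ, 1 ≤ s → s / N ≤ 1 → n * (s / N) ^ 2 ≤ s ^ q)
    (hlarge : ∀ s : ℝ, 1 ≤ s → 1 ≤ s / N → n * (s / N) ^ q ≤ s ^ q) :
    ∫⁻ ω, ENNReal.ofReal (expYoung p (|opA n r g ω| / ((7 * 2 ^ q + 1) * 4 * N))) ≤ 1 := by
  have hY : AEMeasurable (fun ω => opA n r g ω / N) volume :=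
    (aemeasurable_opA n hg hr.aemeasurable).div_const N
  have h := lintegral_expYoung_div_le_one hpq.lt.le (by positivity) (by norm_num)
    (lintegral_expYoung_le_four hpq hY fun s hs => ?_)
  · simpa only [abs_div, abs_of_pos hN, div_div, mul_comm N] using h
  · have hs0 : 0 ≤ s := by linarith
    rcases le_total (s / N) 1 with h1 | h1
    · exact lintegral_exp_mul_abs_opA_div_le hg hr hs0 hN
        (lintegral_cosh_le_exp_sq hpq.lt.le hgp (by positivity) h1) (by linarith [hsmall s hs h1])
    · exact lintegral_exp_mul_abs_opA_div_le hg hr hs0 hN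
        (lintegral_cosh_le_exp_rpow hpq hgp h1) (by linarith [hlarge s hs h1])

theorem lintegral_expYoung_one_opA_le_one {g r : I → ℝ}
    (hg : AEMeasurable g volume) (hr : IsCenteredBernoulli r)
    (hgp : ∫⁻ s, ENNReal.ofReal (expYoung 1 |g s|) ≤ 1) {n : ℕ} (hn : 1 ≤ n) :
    ∫⁻ ω, ENNReal.ofReal (expYoung 1 (|opA n r g ω| / (2 * Real.exp 6 * √n))) ≤ 1 := by
  have hn1 : (1 : ℝ) ≤ √n := Real.one_le_sqrt.2 (by exact_mod_cast hn)
  have hN : 0 < √(n : ℝ) := by linarith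
  -- At `s = 1` the argument `1 / √n` is at most 1, so only the quadratic regime occurs.
  have h1 := lintegral_exp_mul_abs_opA_div_le (n := n) (B := 6) hg hr zero_le_one hN
    (lintegral_cosh_le_exp_sq le_rfl hgp (by positivity) ((div_le_one hN).2 hn1)) (by
      rw [div_pow, Real.sq_sqrt (by positivity)]
      have : (n : ℝ) ≠ 0 := by positivity
      field_simp
      norm_num)
  have h := lintegral_expYoung_div_le_one (Y := fun ω => opA n r g ω / √n) (μ := volume)
    le_rfl one_pos (L := 2 * Real.exp 6) (by linarith [Real.add_one_le_exp (6 : ℝ)]) ?_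
  · simpa only [abs_div, abs_of_pos hN, div_div, one_mul, mul_comm (√(n : ℝ))] using h
  · rw [ENNReal.ofReal_mul zero_le_two, ENNReal.ofReal_ofNat]
    refine (lintegral_mono fun ω => ENNReal.ofReal_le_ofReal ?_).trans h1
    simp [expYoung]

theorem natCast_mul_div_sqrt_sq {n : ℕ} (hn : 1 ≤ n) (s : ℝ) : n * (s / √n) ^ 2 = s ^ 2 := by
  have : (n : ℝ) ≠ 0 := by positivity
  rw [div_pow, Real.sq_sqrt (by positivity)]
  field_simp

theorem natCast_mul_div_rpow_inv {n : ℕ} (hn : 1 ≤ n) {q s : ℝ} (hq : q ≠ 0) (hs : 0 ≤ s) :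
    n * (s / (n : ℝ) ^ q⁻¹) ^ q = s ^ q := by
  have : (n : ℝ) ≠ 0 := by positivity
  rw [Real.div_rpow hs (by positivity), Real.rpow_inv_rpow (by positivity) hq]
  field_simp

theorem mainTheorem8 (p : ℝ≥0∞) (hp : 1 ≤ p) :
    (p ≤ 2 → ∃ C : ℝ, 0 < C ∧ ∀ r : I → ℝ, IsCenteredBernoulli r → ∀ n : ℕ, 1 ≤ n →
      (∀ f : I → ℝ, MemExpL p f volume → MemExpL p (opA n r f) volume) ∧
      opANorm p n r ≤ ENNReal.ofReal (C * Real.sqrt n)) ∧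
    (2 ≤ p → ∃ C : ℝ, 0 < C ∧ ∀ r : I → ℝ, IsCenteredBernoulli r → ∀ n : ℕ, 1 ≤ n →
      (∀ f : I → ℝ, MemExpL p f volume → MemExpL p (opA n r f) volume) ∧
      opANorm p n r ≤ ENNReal.ofReal (C * (n : ℝ) ^ (1 - (p⁻¹).toReal))) := by
  constructor
  · intro hp2
    have hpt : p ≠ ∞ := (hp2.trans_lt ENNReal.ofNat_lt_top).ne
    have hP2 : p.toReal ≤ 2 := by simpa using ENNReal.toReal_mono ENNReal.ofNat_ne_top hp2
    rcases hp.eq_or_lt with rfl | hp1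
    · refine ⟨2 * Real.exp 6, by positivity, fun r hr n hn => memExpL_opA_and_opANorm_le hr
        fun f hf => expLNorm_opA_le hpt (by positivity) (fun g hg hgp => ?_) hf⟩
      rw [ENNReal.toReal_one] at hgp ⊢
      exact lintegral_expYoung_one_opA_le_one hg hr hgp hn
    · have hP1 : 1 < p.toReal := by
        simpa using (ENNReal.toReal_lt_toReal ENNReal.one_ne_top hpt).2 hp1
      have hpq := Real.HolderConjugate.conjExponent hP1
      set q := p.toReal.conjExponent
      have hq2 : 2 ≤ q := by
        have h1 := hpq.inv_add_inv_eq_one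
        have h2 : (2 : ℝ)⁻¹ ≤ p.toReal⁻¹ := inv_anti₀ (by linarith) hP2
        exact (inv_le_inv₀ hpq.symm.pos two_pos).1 (by linarith)
      refine ⟨(7 * 2 ^ q + 1) * 4, by positivity, fun r hr n hn => memExpL_opA_and_opANorm_le hr
        fun f hf => expLNorm_opA_le hpt (by positivity) (fun g hg hgp => ?_) hf⟩
      have hN : 0 < √(n : ℝ) := Real.sqrt_pos.2 (by positivity)
      have hsq {s : ℝ} (hs : 1 ≤ s) : s ^ 2 ≤ s ^ q := by
        rw [← Real.rpow_two]; exact Real.rpow_le_rpow_of_exponent_le hs hq2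
      refine lintegral_expYoung_opA_le_one hpq hg hr hgp hN
        (fun s hs _ => (natCast_mul_div_sqrt_sq hn s).trans_le (hsq hs)) fun s hs h1 => ?_
      have hn1 : (1 : ℝ) ≤ √n := Real.one_le_sqrt.2 (by exact_mod_cast hn)
      -- For large arguments `q ≥ 2` lets `√n ^ q` absorb the factor `n`.
      have hnq : (n : ℝ) ≤ √n ^ q := by
        have h2 : √(n : ℝ) ^ 2 = n := Real.sq_sqrt (by positivity)
        calc (n : ℝ) = √n ^ 2 := h2.symm
          _ ≤ √n ^ q := hsq hn1
      rw [Real.div_rpow (by linarith) hN.le, mul_div_assoc', div_le_iff₀ (by positivity), mul_comm]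
      gcongr
  · intro hp2
    by_cases hpt : p = ∞
    · subst hpt
      refine ⟨1, one_pos, fun r hr n hn => memExpL_opA_and_opANorm_le hr fun f _ => ?_⟩
      simpa [expLNorm] using eLpNorm_top_opA_le hr n f
    · have hP2 : 2 ≤ p.toReal := by simpa using ENNReal.toReal_mono hpt hp2
      have hpq := Real.HolderConjugate.conjExponent (p := p.toReal) (by linarith)
      set q := p.toReal.conjExponent
      have h1 := hpq.inv_add_inv_eq_one
      have hq2 : q ≤ 2 := by
        have h2 : p.toReal⁻¹ ≤ (2 : ℝ)⁻¹ := inv_anti₀ two_pos hP2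
        exact (inv_le_inv₀ two_pos hpq.symm.pos).1 (by linarith)
      have he : 1 - (p⁻¹).toReal = q⁻¹ := by rw [ENNReal.toReal_inv]; linarith
      rw [he]
      refine ⟨(7 * 2 ^ q + 1) * 4, by positivity, fun r hr n hn => memExpL_opA_and_opANorm_le hr
        fun f hf => expLNorm_opA_le hpt (by positivity) (fun g hg hgp => ?_) hf⟩
      have heq {s : ℝ} (hs : 1 ≤ s) :=
        natCast_mul_div_rpow_inv hn hpq.symm.ne_zero (zero_le_one.trans hs)
      refine lintegral_expYoung_opA_le_one hpq hg hr hgp (by positivity) (fun s hs h2 => ?_)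
        fun s hs _ => (heq hs).le
      -- Since `s / N ≤ 1` and `q ≤ 2`, the square is dominated by the `q`-th power.
      refine le_trans ?_ (heq hs).le
      rw [← Real.rpow_two]
      exact mul_le_mul_of_nonneg_left
        (Real.rpow_le_rpow_of_exponent_ge (by positivity) h2 hq2) (Nat.cast_nonneg n)
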